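/- Let $W=\{W(t),\,t\ge 0\}$ be a standard one-dimensional Brownian motion. Let $\vartheta_k\ge 0$ $(k\ge 1)$ be real numbers such that $T_N=\vartheta_1+\dots+\vartheta_N\to\infty$ as $N\to\infty$, and set $I_N=[T_N,T_{N+1}]$. Let $\eta_N\ge 0$ $(N\ge 1)$ be real numbers such that $$\sum_{N\ge 1}\eta_N\,\min\Big(\frac{1}{\sqrt{T_{N+1}-T_N}},\,\frac{1}{\sqrt{T_N}}\Big)<\infty ,$$ where $1/\sqrt{0}=+\infty$ and $0\cdot\infty=0$. Then $$\mathbf P\Big\{\text{there is } N_0 \text{ such that for every } N\ge N_0:\ \inf_{t\in I_N}|W(t)|\ge \eta_N\ \text{ or }\ W(t)=0 \text{ for some } t\in I_N\Big\}=1 .$$ -/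

import Mathlib

open MeasureTheory ProbabilityTheory Filter
open scoped NNReal ENNReal

/-- The partial sums `T_N = ϑ_1 + … + ϑ_N` (the value `ϑ 0` is not used, and `T_0 = 0`). -/
noncomputable def partialTime (ϑ : ℕ → ℝ≥0) (N : ℕ) : ℝ≥0 :=
  ∑ k ∈ Finset.Icc 1 N, ϑ k

/-- The interval `I_N = [T_N, T_{N+1}]` of the half-line `[0, ∞)`. -/
def timeBlock (ϑ : ℕ → ℝ≥0) (N : ℕ) : Set ℝ≥0 :=
  Set.Icc (partialTime ϑ N) (partialTime ϑ (N + 1))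

/-- `1 / √x` as an extended nonnegative number; it is `∞` at `x = 0`. -/
noncomputable def invSqrt (x : ℝ≥0) : ℝ≥0∞ :=
  ((NNReal.sqrt x : ℝ≥0) : ℝ≥0∞)⁻¹

/-- `min (1 / √(T_{N+1} - T_N)) (1 / √T_N)`, with `1 / √0 = ∞`. -/
noncomputable def blockWeight (ϑ : ℕ → ℝ≥0) (N : ℕ) : ℝ≥0∞ :=
  min (invSqrt (partialTime ϑ (N + 1) - partialTime ϑ N)) (invSqrt (partialTime ϑ N))

/-! By Borel–Cantelli it suffices to bound the probability that `0 < min W < η` on `[a, b]`;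
continuity fixes the sign of a path without zeros, and `-W` covers the negative case. Write `W (a +
s) = W a - V s` with `V` a Brownian motion independent of `W a`, so that the minimum is `W a - max
V`. Given `V`, the Gaussian `W a` must fall in an interval of length `η`, which costs a multiple of
`η / √a`. Given `W a = u`, `max V` must fall in an interval of length `η`, which costs a multiple of
`η / √(b - a)` by reflection.

Reflection is carried out on finite grids as two inequalities, `measure_exists_lt_le` and
`two_mul_measure_lt_le`; the second loses an overshoot term that vanishes as the mesh tends to zero.
`measure_positive_min_lt_le` combines both bounds. -/

/-! ### Centred Gaussian laws: small intervals and symmetry -/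

section GaussianEstimates

/-- The density is at most `1 / √(2πv) ≤ 1 / (2√v)`. The factor `1/2` later absorbs the `2` of the
reflection inequalities. For `v = 0` and `x < z` the right side is `∞`. -/
lemma gaussianReal_Ioc_le (v : ℝ≥0) (x z : ℝ) :
    gaussianReal 0 v (Set.Ioc x z) ≤ ENNReal.ofReal (z - x) * invSqrt v / 2 := by
  rcases le_or_gt z x with h | h
  · simp [Set.Ioc_eq_empty_of_le h]
  rcases eq_or_ne v 0 with rfl | hv
  · have : ENNReal.ofReal (z - x) ≠ 0 := by simpa using h
    simp [invSqrt, ENNReal.mul_top this, ENNReal.top_div]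
  have hpdf (t : ℝ) : gaussianPDF 0 v t ≤ invSqrt v / 2 := by
    have hsv : 0 < √(v : ℝ) := Real.sqrt_pos.2 (NNReal.coe_pos.2 (pos_iff_ne_zero.2 hv))
    have h2 : invSqrt v / 2 = ENNReal.ofReal ((√(v : ℝ))⁻¹ / 2) := by
      rw [ENNReal.ofReal_div_of_pos two_pos, ENNReal.ofReal_inv_of_pos hsv, invSqrt]
      simp [← Real.coe_sqrt]
    rw [h2, gaussianPDF]
    refine ENNReal.ofReal_le_ofReal ?_
    have h1 : gaussianPDFReal 0 v t ≤ (√(2 * Real.pi * v))⁻¹ := by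
      rw [gaussianPDFReal]
      refine mul_le_of_le_one_right (by positivity) (Real.exp_le_one_iff.2 ?_)
      rw [neg_div]
      exact neg_nonpos.2 (by positivity)
    refine h1.trans ?_
    have h3 : 2 * √(v : ℝ) ≤ √(2 * Real.pi * v) := by
      refine Real.le_sqrt_of_sq_le ?_
      rw [mul_pow, Real.sq_sqrt v.coe_nonneg]
      have := Real.pi_gt_three
      have hv0 : (0 : ℝ) ≤ v := v.coe_nonneg
      nlinarith
    calc (√(2 * Real.pi * v))⁻¹ ≤ (2 * √(v : ℝ))⁻¹ := inv_anti₀ (by positivity) h3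
      _ = (√(v : ℝ))⁻¹ / 2 := by rw [mul_inv]; ring
  rw [gaussianReal_apply _ hv]
  calc ∫⁻ t in Set.Ioc x z, gaussianPDF 0 v t
      ≤ ∫⁻ _ in Set.Ioc x z, invSqrt v / 2 := lintegral_mono fun t => hpdf t
    _ = ENNReal.ofReal (z - x) * invSqrt v / 2 := by
      rw [setLIntegral_const, Real.volume_Ioc, mul_comm, mul_div_assoc]

lemma gaussianReal_Ioi_zero_eq (v : ℝ≥0) :
    gaussianReal 0 v (Set.Ioi 0) = gaussianReal 0 v (Set.Iio 0) := by
  have h := gaussianReal_map_neg (μ := 0) (v := v)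
  rw [neg_zero] at h
  conv_lhs => rw [← h, Measure.map_apply measurable_neg measurableSet_Ioi]
  congr 1
  ext x
  simp

lemma two_mul_gaussianReal_Ioi_zero_le (v : ℝ≥0) : 2 * gaussianReal 0 v (Set.Ioi 0) ≤ 1 := by
  have hd : Disjoint (Set.Ioi (0 : ℝ)) (Set.Iio 0) :=
    Set.disjoint_left.2 fun x hx hx' => lt_asymm (Set.mem_Ioi.1 hx) (Set.mem_Iio.1 hx')
  rw [two_mul]
  nth_rw 2 [gaussianReal_Ioi_zero_eq]
  rw [← measure_union hd measurableSet_Iio]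
  exact prob_le_one

lemma one_le_two_mul_gaussianReal_Ici_zero (v : ℝ≥0) :
    1 ≤ 2 * gaussianReal 0 v (Set.Ici 0) := by
  have h : (1 : ℝ≥0∞) = gaussianReal 0 v (Set.Ici 0 ∪ Set.Iio 0) := by
    rw [Set.Ici_union_Iio, measure_univ]
  rw [h, two_mul]
  refine (measure_union_le _ _).trans (add_le_add_right ?_ _)
  rw [← gaussianReal_Ioi_zero_eq]
  exact measure_mono Set.Ioi_subset_Ici_self

end GaussianEstimates

/-! ### Conditioning on an independent variable -/

section Independence

variable {Ω : Type*} [MeasurableSpace Ω] {P : Measure Ω} [IsProbabilityMeasure P]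

lemma measure_mem_le_of_indepFun {α β : Type*} [MeasurableSpace α] [MeasurableSpace β]
    {X : Ω → α} {Y : Ω → β} (hX : Measurable X) (hY : Measurable Y) (hXY : IndepFun X Y P)
    {s : Set (α × β)} (hs : MeasurableSet s) {C : ℝ≥0∞}
    (hC : ∀ x, P {ω | (x, Y ω) ∈ s} ≤ C) : P {ω | (X ω, Y ω) ∈ s} ≤ C := by
  have hlaw := (indepFun_iff_map_prod_eq_prod_map_map hX.aemeasurable hY.aemeasurable).1 hXY
  have hpX : IsProbabilityMeasure (P.map X) := Measure.isProbabilityMeasure_map hX.aemeasurable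
  have hpY : IsProbabilityMeasure (P.map Y) := Measure.isProbabilityMeasure_map hY.aemeasurable
  calc P {ω | (X ω, Y ω) ∈ s} = P.map (fun ω => (X ω, Y ω)) s :=
        (Measure.map_apply (hX.prodMk hY) hs).symm
    _ = ∫⁻ x, P.map Y (Prod.mk x ⁻¹' s) ∂(P.map X) := by rw [hlaw, Measure.prod_apply hs]
    _ ≤ ∫⁻ _, C ∂(P.map X) := by
        refine lintegral_mono fun x => ?_
        rw [Measure.map_apply hY (measurable_prodMk_left hs)]
        exact hC x
    _ = C := by simp

end Independence

/-! ### Discrete reflection inequalities -/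

section FirstPassage

variable {Ω : Type*}

/-- The event that the sequence `S` exceeds the level `x` at time `i` for the first time. -/
def firstPassage (S : ℕ → Ω → ℝ) (x : ℝ) (i : ℕ) : Set Ω :=
  {ω | x < S i ω ∧ ∀ j < i, S j ω ≤ x}

lemma disjoint_firstPassage (S : ℕ → Ω → ℝ) (x : ℝ) {i j : ℕ} (hij : i ≠ j) :
    Disjoint (firstPassage S x i) (firstPassage S x j) := by
  refine Set.disjoint_left.2 fun ω hi hj => ?_
  rcases lt_or_gt_of_ne hij with h | h
  · exact absurd hi.1 (hj.2 i h).not_gt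
  · exact absurd hj.1 (hi.2 j h).not_gt

lemma exists_mem_firstPassage {S : ℕ → Ω → ℝ} {x : ℝ} {ω : Ω} {n : ℕ}
    (h : ∃ i ≤ n, x < S i ω) : ∃ i ≤ n, ω ∈ firstPassage S x i := by
  classical
  obtain ⟨i, hi, hx⟩ := h
  have hex : ∃ i, x < S i ω := ⟨i, hx⟩
  exact ⟨Nat.find hex, (Nat.find_min' hex hx).trans hi, Nat.find_spec hex,
    fun j hj => not_lt.1 (Nat.find_min hex hj)⟩

lemma setOf_exists_lt_eq_biUnion_firstPassage (S : ℕ → Ω → ℝ) (x : ℝ) (n : ℕ) :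
    {ω | ∃ i ≤ n, x < S i ω} = ⋃ i ∈ Finset.range (n + 1), firstPassage S x i := by
  ext ω
  simp only [Set.mem_ofPred_eq, Set.mem_iUnion, Finset.mem_range, Nat.lt_succ_iff, exists_prop]
  exact ⟨exists_mem_firstPassage, fun ⟨i, hi, hω⟩ => ⟨i, hi, hω.1⟩⟩

variable [MeasurableSpace Ω] {P : Measure Ω} {S : ℕ → Ω → ℝ} {n : ℕ}

lemma measurableSet_firstPassage (hS : ∀ i, Measurable (S i)) (x : ℝ) (i : ℕ) :
    MeasurableSet (firstPassage S x i) := by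
  have h : firstPassage S x i = {ω | x < S i ω} ∩ ⋂ j : ℕ, ⋂ _ : j < i, {ω | S j ω ≤ x} := by
    ext ω
    simp [firstPassage]
  rw [h]
  exact (measurableSet_lt measurable_const (hS i)).inter
    (.iInter fun j => .iInter fun _ => measurableSet_le (hS j) measurable_const)

lemma measure_exists_lt_eq_sum (hS : ∀ i, Measurable (S i)) (x : ℝ) :
    P {ω | ∃ i ≤ n, x < S i ω} = ∑ i ∈ Finset.range (n + 1), P (firstPassage S x i) := by
  rw [setOf_exists_lt_eq_biUnion_firstPassage, measure_biUnion_finset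
    (fun i _ j _ hij => disjoint_firstPassage S x hij)
    (fun i _ => measurableSet_firstPassage hS x i)]

lemma measure_firstPassage_inter (hind : ∀ i ≤ n,
      IndepFun (fun ω => S n ω - S i ω) (fun ω (j : Set.Iic i) => S j ω) P)
    {i : ℕ} (hi : i ≤ n) (x : ℝ) {C : Set ℝ} (hC : MeasurableSet C) :
    P (firstPassage S x i ∩ {ω | S n ω - S i ω ∈ C}) =
      P (firstPassage S x i) * P {ω | S n ω - S i ω ∈ C} := by
  let A : Set (Set.Iic i → ℝ) := {f | x < f ⟨i, Set.self_mem_Iic⟩ ∧ ∀ j : Set.Iic i, (j : ℕ) < i → f j ≤ x}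
  have hA : MeasurableSet A := by
    have h : A = {f | x < f ⟨i, Set.self_mem_Iic⟩} ∩
        ⋂ j : Set.Iic i, ⋂ _ : (j : ℕ) < i, {f | f j ≤ x} := by
      ext f
      simp [A]
    rw [h]
    exact (measurableSet_lt measurable_const (measurable_pi_apply _)).inter
      (.iInter fun j => .iInter fun _ => measurableSet_le (measurable_pi_apply _) measurable_const)
  have hpre : firstPassage S x i = (fun ω (j : Set.Iic i) => S j ω) ⁻¹' A := by
    ext ω
    exact ⟨fun h => ⟨h.1, fun j hj => h.2 j hj⟩, fun h => ⟨h.1, fun j hj => h.2 ⟨j, hj.le⟩ hj⟩⟩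
  rw [hpre, Set.inter_comm, mul_comm]
  exact (hind i hi).measure_inter_preimage_eq_mul _ _ hC hA

/-- After the first passage above `x`, the remaining increment is independent of the past and
nonnegative with probability at least `1/2`, which keeps `S n` above `x`. -/
lemma measure_exists_lt_le (hS : ∀ i, Measurable (S i))
    (hind : ∀ i ≤ n, IndepFun (fun ω => S n ω - S i ω) (fun ω (j : Set.Iic i) => S j ω) P)
    (hpos : ∀ i ≤ n, 1 ≤ 2 * P {ω | S n ω - S i ω ∈ Set.Ici 0}) (x : ℝ) :
    P {ω | ∃ i ≤ n, x < S i ω} ≤ 2 * P {ω | x < S n ω} := by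
  have hmeas (i : ℕ) :
      MeasurableSet (firstPassage S x i ∩ {ω | S n ω - S i ω ∈ Set.Ici 0}) :=
    (measurableSet_firstPassage hS x i).inter (((hS n).sub (hS i)) measurableSet_Ici)
  calc P {ω | ∃ i ≤ n, x < S i ω}
      = ∑ i ∈ Finset.range (n + 1), P (firstPassage S x i) := measure_exists_lt_eq_sum hS x
    _ ≤ ∑ i ∈ Finset.range (n + 1),
          2 * P (firstPassage S x i ∩ {ω | S n ω - S i ω ∈ Set.Ici 0}) := by
        refine Finset.sum_le_sum fun i hi => ?_
        have hi' : i ≤ n := Nat.lt_succ_iff.1 (Finset.mem_range.1 hi)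
        rw [measure_firstPassage_inter hind hi' x measurableSet_Ici, mul_left_comm]
        exact le_mul_of_one_le_right' (hpos i hi')
    _ = 2 * P (⋃ i ∈ Finset.range (n + 1),
          (firstPassage S x i ∩ {ω | S n ω - S i ω ∈ Set.Ici 0})) := by
        rw [← Finset.mul_sum, measure_biUnion_finset
          (fun i _ j _ hij => (disjoint_firstPassage S x hij).mono
            Set.inter_subset_left Set.inter_subset_left) (fun i _ => hmeas i)]
    _ ≤ 2 * P {ω | x < S n ω} := by
        gcongr
        refine Set.iUnion₂_subset fun i _ ω hω => ?_
        have h1 := hω.1.1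
        have h2 : 0 ≤ S n ω - S i ω := hω.2
        simp only [Set.mem_ofPred_eq]
        linarith

/-- Converse half of reflection: if no step exceeds `δ`, the first passage above `y` lands at most
at `y + δ`. Ending above `y + δ` then needs a positive remaining increment, of probability at most
`1/2`. -/
lemma two_mul_measure_lt_le (hS : ∀ i, Measurable (S i))
    (hind : ∀ i ≤ n, IndepFun (fun ω => S n ω - S i ω) (fun ω (j : Set.Iic i) => S j ω) P)
    (hneg : ∀ i ≤ n, 2 * P {ω | S n ω - S i ω ∈ Set.Ioi 0} ≤ 1) {y δ : ℝ} (hδ : 0 ≤ δ)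
    (h0 : ∀ᵐ ω ∂P, S 0 ω ≤ y) :
    2 * P {ω | y + δ < S n ω} ≤ P {ω | ∃ i ≤ n, y < S i ω} +
      2 * P {ω | ∃ i < n, δ < S (i + 1) ω - S i ω} := by
  have hsub : {ω | y + δ < S n ω} ≤ᵐ[P]
      ((⋃ i ∈ Finset.range (n + 1), (firstPassage S y i ∩ {ω | S n ω - S i ω ∈ Set.Ioi 0})) ∪
        {ω | ∃ i < n, δ < S (i + 1) ω - S i ω} : Set Ω) := by
    filter_upwards [h0] with ω hω0 hω
    have hω' : y + δ < S n ω := hω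
    by_cases hbad : ∃ i < n, δ < S (i + 1) ω - S i ω
    · exact Or.inr hbad
    refine Or.inl ?_
    push Not at hbad
    obtain ⟨i, hi, hfp⟩ := exists_mem_firstPassage (S := S) (x := y) (ω := ω) (n := n)
      ⟨n, le_rfl, by linarith⟩
    -- Passage at time `0` has no preceding step to bound the overshoot; `h0` excludes it.
    have hi0 : i ≠ 0 := by
      rintro rfl
      exact absurd hfp.1 hω0.not_gt
    obtain ⟨k, rfl⟩ := Nat.exists_eq_succ_of_ne_zero hi0
    have h1 := hbad k (by omega)
    have h2 := hfp.2 k (by omega)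
    refine Set.mem_biUnion (x := k + 1) (by simpa using hi) ⟨hfp, ?_⟩
    simp only [Set.mem_ofPred_eq, Set.mem_Ioi]
    linarith
  calc 2 * P {ω | y + δ < S n ω}
      ≤ 2 * (∑ i ∈ Finset.range (n + 1),
          P (firstPassage S y i ∩ {ω | S n ω - S i ω ∈ Set.Ioi 0}) +
        P {ω | ∃ i < n, δ < S (i + 1) ω - S i ω}) := by
        gcongr
        refine (measure_mono_ae hsub).trans ((measure_union_le _ _).trans ?_)
        gcongr
        exact measure_biUnion_finset_le _ _
    _ ≤ _ := by
        rw [mul_add, measure_exists_lt_eq_sum hS y, Finset.mul_sum]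
        gcongr with i hi
        have hi' : i ≤ n := Nat.lt_succ_iff.1 (Finset.mem_range.1 hi)
        rw [measure_firstPassage_inter hind hi' y measurableSet_Ioi, mul_left_comm]
        exact mul_le_of_le_one_right' (hneg i hi')

lemma measure_exists_lt_and_forall_le [IsFiniteMeasure P] (hS : ∀ i, Measurable (S i))
    (hind : ∀ i ≤ n, IndepFun (fun ω => S n ω - S i ω) (fun ω (j : Set.Iic i) => S j ω) P)
    (hpos : ∀ i ≤ n, 1 ≤ 2 * P {ω | S n ω - S i ω ∈ Set.Ici 0})
    (hneg : ∀ i ≤ n, 2 * P {ω | S n ω - S i ω ∈ Set.Ioi 0} ≤ 1)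
    {x y δ : ℝ} (hxy : x ≤ y) (hδ : 0 ≤ δ) (h0 : ∀ᵐ ω ∂P, S 0 ω ≤ y) :
    P {ω | (∃ i ≤ n, x < S i ω) ∧ ∀ i ≤ n, S i ω ≤ y} ≤
      2 * P {ω | S n ω ∈ Set.Ioc x (y + δ)} +
        2 * P {ω | ∃ i < n, δ < S (i + 1) ω - S i ω} := by
  have hAy : MeasurableSet {ω | ∃ i ≤ n, y < S i ω} := by
    rw [setOf_exists_lt_eq_biUnion_firstPassage]
    exact Finset.measurableSet_biUnion _ fun i _ => measurableSet_firstPassage hS y i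
  have hdiff : {ω | (∃ i ≤ n, x < S i ω) ∧ ∀ i ≤ n, S i ω ≤ y} =
      {ω | ∃ i ≤ n, x < S i ω} \ {ω | ∃ i ≤ n, y < S i ω} := by
    ext ω
    simp
  have hsub : {ω | ∃ i ≤ n, y < S i ω} ⊆ {ω | ∃ i ≤ n, x < S i ω} :=
    fun ω ⟨i, hi, h⟩ => ⟨i, hi, hxy.trans_lt h⟩
  rw [hdiff, measure_sdiff hsub hAy.nullMeasurableSet (measure_ne_top _ _), tsub_le_iff_right]
  calc P {ω | ∃ i ≤ n, x < S i ω} ≤ 2 * P {ω | x < S n ω} := measure_exists_lt_le hS hind hpos x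
    _ ≤ 2 * (P {ω | S n ω ∈ Set.Ioc x (y + δ)} + P {ω | y + δ < S n ω}) := by
        gcongr
        refine (measure_mono fun ω hω => ?_).trans (measure_union_le _ _)
        rcases le_or_gt (S n ω) (y + δ) with h | h
        · exact Or.inl ⟨hω, h⟩
        · exact Or.inr h
    _ ≤ 2 * P {ω | S n ω ∈ Set.Ioc x (y + δ)} + (P {ω | ∃ i ≤ n, y < S i ω} +
          2 * P {ω | ∃ i < n, δ < S (i + 1) ω - S i ω}) := by
        rw [mul_add]
        gcongr
        exact two_mul_measure_lt_le hS hind hneg hδ h0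
    _ = _ := by ring

end FirstPassage

/-! ### Limits of probabilities along grid approximations -/

section Limits

variable {Ω : Type*} [MeasurableSpace Ω] {P : Measure Ω}

lemma tendsto_measure_zero_of_eventually_notMem [IsFiniteMeasure P] {B : ℕ → Set Ω}
    (hB : ∀ k, MeasurableSet (B k)) (h : ∀ ω, ∀ᶠ k in atTop, ω ∉ B k) :
    Tendsto (fun k => P (B k)) atTop (nhds 0) := by
  have hanti : Antitone fun k => ⋃ j ≥ k, B j := fun k l hkl =>
    Set.iUnion₂_mono' fun j hj => ⟨j, hkl.trans hj, le_rfl⟩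
  have hempty : ⋂ k, ⋃ j ≥ k, B j = ∅ := by
    refine Set.eq_empty_of_forall_notMem fun ω hω => ?_
    obtain ⟨k, hk⟩ := eventually_atTop.1 (h ω)
    obtain ⟨j, hj, hmem⟩ := Set.mem_iUnion₂.1 (Set.mem_iInter.1 hω k)
    exact hk j hj hmem
  have hlim := tendsto_measure_iInter_atTop (μ := P)
    (fun k => (MeasurableSet.iUnion fun j => .iUnion fun _ => hB j).nullMeasurableSet) hanti
    ⟨0, measure_ne_top _ _⟩
  rw [hempty, measure_empty] at hlim
  exact tendsto_of_tendsto_of_tendsto_of_le_of_le tendsto_const_nhds hlim (fun _ => zero_le)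
    fun k => measure_mono (Set.subset_biUnion_of_mem (u := B) (le_refl k))

lemma measure_le_of_eventually_mem {A : Set Ω} {B : ℕ → Set Ω} {C : ℝ≥0∞} {e : ℕ → ℝ≥0∞}
    (h : ∀ ω ∈ A, ∀ᶠ k in atTop, ω ∈ B k) (hB : ∀ k, P (B k) ≤ C + e k)
    (he : Tendsto e atTop (nhds 0)) : P A ≤ C := by
  have hmono : Monotone fun k => ⋂ j ≥ k, B j := fun k l hkl =>
    Set.iInter₂_mono' fun j hj => ⟨j, hkl.trans hj, le_rfl⟩
  have hsub : A ⊆ ⋃ k, ⋂ j ≥ k, B j := fun ω hω => by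
    obtain ⟨k, hk⟩ := eventually_atTop.1 (h ω hω)
    exact Set.mem_iUnion.2 ⟨k, Set.mem_iInter₂.2 hk⟩
  refine (measure_mono hsub).trans ?_
  rw [hmono.measure_iUnion]
  refine iSup_le fun k => ?_
  have hlim : Tendsto (fun j => C + e j) atTop (nhds C) := by
    simpa using tendsto_const_nhds.add he
  refine ge_of_tendsto hlim (eventually_atTop.2 ⟨k, fun j hj => ?_⟩)
  exact (measure_mono (Set.biInter_subset_of_mem hj)).trans (hB j)

end Limits

/-! ### Uniform grids -/

section UniformGrid

/-- The `i`-th point of the partition of `[0, d]` into `k + 1` intervals of equal length. -/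
noncomputable def gridPoint (d : ℝ≥0) (k i : ℕ) : ℝ≥0 := d * (i / (k + 1 : ℕ))

lemma gridPoint_zero (d : ℝ≥0) (k : ℕ) : gridPoint d k 0 = 0 := by simp [gridPoint]

lemma gridPoint_last (d : ℝ≥0) (k : ℕ) : gridPoint d k (k + 1) = d := by
  rw [gridPoint, div_self (by positivity), mul_one]

lemma monotone_gridPoint (d : ℝ≥0) (k : ℕ) : Monotone (gridPoint d k) := fun i j hij => by
  unfold gridPoint
  gcongr

lemma gridPoint_le (d : ℝ≥0) {k i : ℕ} (hi : i ≤ k + 1) : gridPoint d k i ≤ d :=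
  (monotone_gridPoint d k hi).trans_eq (gridPoint_last d k)

lemma dist_gridPoint_succ (d : ℝ≥0) (k i : ℕ) :
    dist (gridPoint d k (i + 1)) (gridPoint d k i) = d / ((k : ℝ) + 1) := by
  rw [NNReal.dist_eq]
  have h : (gridPoint d k (i + 1) : ℝ) - gridPoint d k i = d / ((k : ℝ) + 1) := by
    simp only [gridPoint]
    push_cast
    ring
  rw [h, abs_of_nonneg (by positivity)]

lemma exists_tendsto_gridPoint {d s : ℝ≥0} (hs : s ≤ d) :
    ∃ i : ℕ → ℕ, (∀ k, i k ≤ k + 1) ∧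
      Tendsto (fun k => gridPoint d k (i k)) atTop (nhds s) := by
  have hr : (s / d : ℝ≥0) ≤ 1 := div_le_one_of_le₀ hs zero_le
  have hr' : ((s / d : ℝ≥0) : ℝ) ≤ 1 := by exact_mod_cast hr
  have hds : d * (s / d) = s := by
    rcases eq_or_ne d 0 with rfl | hd
    · simpa using hs.antisymm zero_le |>.symm
    · field_simp
  -- The nearest grid point at or below `s`; for `d = 0` the convention `s / 0 = 0` gives index `0`.
  refine ⟨fun k => ⌊((s / d : ℝ≥0) : ℝ) * ((k + 1 : ℕ) : ℝ)⌋₊, fun k => ?_, ?_⟩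
  · refine Nat.floor_le_of_le ?_
    exact mul_le_of_le_one_left (by positivity) hr'
  · have hlim : Tendsto (fun k : ℕ => (⌊((s / d : ℝ≥0) : ℝ) * ((k + 1 : ℕ) : ℝ)⌋₊ : ℝ) /
        ((k + 1 : ℕ) : ℝ)) atTop (nhds ((s / d : ℝ≥0) : ℝ)) :=
      (tendsto_nat_floor_mul_div_atTop (s / d : ℝ≥0).coe_nonneg).comp
        (tendsto_natCast_atTop_atTop.comp (tendsto_add_atTop_nat 1))
    have hlim' : Tendsto (fun k : ℕ => ((⌊((s / d : ℝ≥0) : ℝ) * ((k + 1 : ℕ) : ℝ)⌋₊ : ℝ≥0) /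
        ((k + 1 : ℕ) : ℝ≥0))) atTop (nhds (s / d)) := by
      rw [← NNReal.tendsto_coe]
      simpa using hlim
    have := hlim'.const_mul d
    rwa [hds] at this

end UniformGrid

/-! ### Minimum of a Brownian path over an interval -/

section BrownianMotion

variable {Ω : Type*} [MeasurableSpace Ω] {P : Measure Ω} {V W : ℝ≥0 → Ω → ℝ}

/-- Zero out the path on a measurable null set outside which it is continuous and agrees with
measurable modifications at a dense sequence of times. Measurability at other times follows by
pointwise limits. -/
lemma ProbabilityTheory.IsBrownianReal.exists_continuous_version (hW : IsBrownianReal W P) :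
    ∃ X : ℝ≥0 → Ω → ℝ, (∀ t, Measurable (X t)) ∧ (∀ ω, Continuous (X · ω)) ∧
      IsBrownianReal X P ∧ ∀ᵐ ω ∂P, ∀ t, W t ω = X t ω := by
  classical
  let D : ℕ → ℝ≥0 := TopologicalSpace.denseSeq ℝ≥0
  have hae : ∀ᵐ ω ∂P, Continuous (W · ω) ∧
      ∀ n, W (D n) ω = (hW.aemeasurable (D n)).mk (W (D n)) ω :=
    hW.cont.and (ae_all_iff.2 fun n => (hW.aemeasurable (D n)).ae_eq_mk)
  obtain ⟨N, hN, hNm, hN0⟩ := exists_measurable_superset_of_null (ae_iff.1 hae)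
  have hgood : ∀ ω ∈ Nᶜ, Continuous (W · ω) ∧
      ∀ n, W (D n) ω = (hW.aemeasurable (D n)).mk (W (D n)) ω := fun ω hω => by
    by_contra h
    exact hω (hN h)
  let X : ℝ≥0 → Ω → ℝ := fun t => Nᶜ.indicator (W t)
  have hcont (ω : Ω) : Continuous (X · ω) := by
    by_cases hω : ω ∈ Nᶜ
    · simpa [X, hω] using (hgood ω hω).1
    · simpa [X, hω] using continuous_const
  have heq : ∀ᵐ ω ∂P, ∀ t, W t ω = X t ω := by
    filter_upwards [compl_mem_ae_iff.2 hN0] with ω hω t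
    exact (Set.indicator_of_mem hω _).symm
  refine ⟨X, fun t => ?_, hcont, ⟨hW.toIsPreBrownianReal.congr fun t => ?_, ?_⟩, heq⟩
  · have hD (n : ℕ) : Measurable (X (D n)) := by
      have h : X (D n) = Nᶜ.indicator ((hW.aemeasurable (D n)).mk (W (D n))) :=
        Set.indicator_congr fun ω hω => (hgood ω hω).2 n
      rw [h]
      exact (hW.aemeasurable (D n)).measurable_mk.indicator hNm.compl
    obtain ⟨u, hu, hut⟩ := mem_closure_iff_seq_limit.1
      (TopologicalSpace.denseRange_denseSeq ℝ≥0 t)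
    choose n hn using hu
    refine measurable_of_tendsto_metrizable (fun k => hD (n k)) (tendsto_pi_nhds.2 fun ω => ?_)
    have hDn : (fun k => X (D (n k)) ω) = fun k => X (u k) ω := by
      funext k
      exact congrArg (X · ω) (hn k)
    rw [hDn]
    exact ((hcont ω).tendsto t).comp hut
  · filter_upwards [heq] with ω hω using hω t
  · exact .of_forall hcont

lemma ProbabilityTheory.IsPreBrownianReal.measure_sub_mem (hV : IsPreBrownianReal V P)
    (s t : ℝ≥0) {C : Set ℝ} (hC : MeasurableSet C) :
    P {ω | V s ω - V t ω ∈ C} = gaussianReal 0 (nndist s.1 t.1) C := by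
  have h := hV.hasLaw_sub s t
  rw [← h.map_eq, Measure.map_apply_of_aemeasurable h.aemeasurable hC]
  rfl

lemma ProbabilityTheory.IsPreBrownianReal.measure_mem (hV : IsPreBrownianReal V P)
    (t : ℝ≥0) {C : Set ℝ} (hC : MeasurableSet C) :
    P {ω | V t ω ∈ C} = gaussianReal 0 t C := by
  have h := hV.hasLaw_eval t
  rw [← h.map_eq, Measure.map_apply_of_aemeasurable h.aemeasurable hC]
  rfl

lemma ProbabilityTheory.IsPreBrownianReal.indepFun_sub_of_monotone (hV : IsPreBrownianReal V P)
    {t : ℕ → ℝ≥0} (ht : Monotone t) {i n : ℕ} (hi : i ≤ n) :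
    IndepFun (fun ω => V (t n) ω - V (t i) ω) (fun ω (j : Set.Iic i) => V (t j) ω) P := by
  have hφ : Measurable fun f : ℝ≥0 → ℝ => f (t n - t i) := measurable_pi_apply _
  have hψ : Measurable fun (f : Set.Iic (t i) → ℝ) (j : Set.Iic i) => f ⟨t j, ht j.2⟩ :=
    measurable_pi_lambda _ fun j => measurable_pi_apply _
  have h := (hV.indepFun_shift (t i)).comp hφ hψ
  have htn : t i + (t n - t i) = t n := add_tsub_cancel_of_le (ht hi)
  simpa only [Function.comp_def, htn] using h

/-- Anticoncentration of the maximum of a Brownian motion along a finite grid. -/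
lemma ProbabilityTheory.IsPreBrownianReal.measure_grid_max_le (hV : IsPreBrownianReal V P)
    (hm : ∀ t, Measurable (V t)) {t : ℕ → ℝ≥0} (ht : Monotone t) (ht0 : t 0 = 0) (n : ℕ)
    {x y δ : ℝ} (hxy : x ≤ y) (hy : 0 ≤ y) (hδ : 0 ≤ δ) :
    P {ω | (∃ i ≤ n, x < V (t i) ω) ∧ ∀ i ≤ n, V (t i) ω ≤ y} ≤
      ENNReal.ofReal (y + δ - x) * invSqrt (t n) +
        2 * P {ω | ∃ i < n, δ < V (t (i + 1)) ω - V (t i) ω} := by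
  have hP : IsProbabilityMeasure P := hV.isGaussianProcess.isProbabilityMeasure
  refine (measure_exists_lt_and_forall_le (S := fun i => V (t i)) (fun i => hm _)
    (fun i hi => hV.indepFun_sub_of_monotone ht hi) (fun i _ => ?_) (fun i _ => ?_)
    hxy hδ ?_).trans ?_
  · rw [hV.measure_sub_mem _ _ measurableSet_Ici]
    exact one_le_two_mul_gaussianReal_Ici_zero _
  · rw [hV.measure_sub_mem _ _ measurableSet_Ioi]
    exact two_mul_gaussianReal_Ioi_zero_le _
  · filter_upwards [hV.eval_zero_ae_eq_zero] with ω hω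
    simpa [ht0, hω] using hy
  · refine add_le_add_left ?_ _
    rw [hV.measure_mem _ measurableSet_Ioc]
    calc 2 * gaussianReal 0 (t n) (Set.Ioc x (y + δ))
        ≤ 2 * (ENNReal.ofReal (y + δ - x) * invSqrt (t n) / 2) := by
          gcongr
          exact gaussianReal_Ioc_le _ _ _
      _ = _ := ENNReal.mul_div_cancel two_ne_zero ENNReal.ofNat_ne_top

/-- The pairs `(u, f)` such that the minimum of `u - f` over the grid `t 0, …, t n` lies
in the interval `(0, η)`. -/
def gridMinSet (t : ℕ → ℝ≥0) (n : ℕ) (η : ℝ) : Set (ℝ × (ℝ≥0 → ℝ)) :=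
  {p | (∃ i ≤ n, p.1 - η < p.2 (t i)) ∧ ∀ i ≤ n, p.2 (t i) < p.1}

lemma measurableSet_gridMinSet (t : ℕ → ℝ≥0) (n : ℕ) (η : ℝ) :
    MeasurableSet (gridMinSet t n η) := by
  have h : gridMinSet t n η = (⋃ i : ℕ, ⋃ _ : i ≤ n, {p | p.1 - η < p.2 (t i)}) ∩
      ⋂ i : ℕ, ⋂ _ : i ≤ n, {p | p.2 (t i) < p.1} := by
    ext p
    simp [gridMinSet]
  have hev (i : ℕ) : Measurable fun p : ℝ × (ℝ≥0 → ℝ) => p.2 (t i) :=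
    (measurable_pi_apply _).comp measurable_snd
  rw [h]
  exact (MeasurableSet.iUnion fun i => .iUnion fun _ =>
    measurableSet_lt (measurable_fst.sub_const η) (hev i)).inter
    (.iInter fun i => .iInter fun _ => measurableSet_lt (hev i) measurable_fst)

lemma exists_gridMinSet_subset_Ioc (t : ℕ → ℝ≥0) (n : ℕ) (η : ℝ) (f : ℝ≥0 → ℝ) :
    ∃ m : ℝ, ∀ u, (u, f) ∈ gridMinSet t n η → u ∈ Set.Ioc m (m + η) := by
  obtain ⟨j, hj, hmax⟩ := Finset.exists_max_image (Finset.range (n + 1)) (fun i => f (t i))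
    ⟨0, by simp⟩
  refine ⟨f (t j), fun u ⟨⟨i, hi, hlt⟩, hall⟩ =>
    ⟨hall j (Nat.lt_succ_iff.1 (Finset.mem_range.1 hj)), ?_⟩⟩
  have h1 := hmax i (Finset.mem_range.2 (Nat.lt_succ_iff.2 hi))
  have h2 : u - η < f (t i) := hlt
  linarith

variable {U : Ω → ℝ} {a : ℝ≥0}

/-- Freeze the path `V` and let `U` vary: this bound is uniform in the grid. -/
lemma measure_gridMinSet_le_of_gaussian [IsProbabilityMeasure P] (hm : ∀ t, Measurable (V t))
    (hU : Measurable U) (hlaw : P.map U = gaussianReal 0 a)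
    (hUV : IndepFun U (fun ω s => V s ω) P) (t : ℕ → ℝ≥0) (n : ℕ) (η : ℝ) :
    P {ω | (U ω, fun s => V s ω) ∈ gridMinSet t n η} ≤ ENNReal.ofReal η * invSqrt a := by
  refine measure_mem_le_of_indepFun (measurable_pi_lambda _ hm) hU hUV.symm
    (s := Prod.swap ⁻¹' gridMinSet t n η)
    (measurable_swap (measurableSet_gridMinSet t n η)) fun f => ?_
  obtain ⟨m, hmem⟩ := exists_gridMinSet_subset_Ioc t n η f
  calc P {ω | (f, U ω) ∈ Prod.swap ⁻¹' gridMinSet t n η}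
      ≤ P (U ⁻¹' Set.Ioc m (m + η)) := measure_mono fun ω hω => hmem _ hω
    _ = gaussianReal 0 a (Set.Ioc m (m + η)) := by
        rw [← hlaw, Measure.map_apply hU measurableSet_Ioc]
    _ ≤ ENNReal.ofReal (m + η - m) * invSqrt a / 2 := gaussianReal_Ioc_le _ _ _
    _ ≤ ENNReal.ofReal η * invSqrt a := by
        rw [add_sub_cancel_left]
        exact ENNReal.div_le_of_le_mul (le_mul_of_one_le_right' one_le_two)

/-- Freeze `U` instead and apply anticoncentration of the grid maximum of `V`. A negative value of
`U` contributes nothing, since `V` starts at `0`. -/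
lemma ProbabilityTheory.IsPreBrownianReal.measure_gridMinSet_le (hV : IsPreBrownianReal V P)
    (hm : ∀ t, Measurable (V t)) (hU : Measurable U)
    (hUV : IndepFun U (fun ω s => V s ω) P) {t : ℕ → ℝ≥0} (ht : Monotone t) (ht0 : t 0 = 0)
    (n : ℕ) {η δ : ℝ} (hη : 0 ≤ η) (hδ : 0 ≤ δ) :
    P {ω | (U ω, fun s => V s ω) ∈ gridMinSet t n η} ≤
      ENNReal.ofReal (η + δ) * invSqrt (t n) +
        2 * P {ω | ∃ i < n, δ < V (t (i + 1)) ω - V (t i) ω} := by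
  have hP : IsProbabilityMeasure P := hV.isGaussianProcess.isProbabilityMeasure
  refine measure_mem_le_of_indepFun hU (measurable_pi_lambda _ hm) hUV
    (measurableSet_gridMinSet t n η) fun u => ?_
  rcases lt_or_ge u 0 with hu | hu
  · have hnull : P {ω | (u, fun s => V s ω) ∈ gridMinSet t n η} = 0 := by
      refine measure_eq_zero_iff_ae_notMem.2 ?_
      filter_upwards [hV.eval_zero_ae_eq_zero] with ω hω hmem
      have h0 : V (t 0) ω < u := hmem.2 0 n.zero_le
      rw [ht0, hω] at h0
      exact lt_asymm h0 hu
    rw [hnull]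
    exact zero_le
  · have h := hV.measure_grid_max_le hm ht ht0 n (x := u - η) (y := u) (by linarith) hu hδ
    rw [show u + δ - (u - η) = η + δ by ring] at h
    refine le_trans (measure_mono ?_) h
    exact fun ω hω => ⟨hω.1, fun i hi => (hω.2 i hi).le⟩

lemma eventually_forall_sub_gridPoint_le {f : ℝ≥0 → ℝ} (hf : Continuous f) (d : ℝ≥0)
    {δ : ℝ} (hδ : 0 < δ) :
    ∀ᶠ k in atTop, ∀ i < k + 1, f (gridPoint d k (i + 1)) - f (gridPoint d k i) ≤ δ := by
  obtain ⟨ε, hε, h⟩ := Metric.uniformContinuousOn_iff.1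
    ((isCompact_Icc (a := (0 : ℝ≥0)) (b := d)).uniformContinuousOn_of_continuous
      hf.continuousOn) δ hδ
  have hlim : Tendsto (fun k : ℕ => (d : ℝ) / ((k : ℝ) + 1)) atTop (nhds 0) := by
    simpa [div_eq_mul_inv] using
      (tendsto_one_div_add_atTop_nhds_zero_nat (𝕜 := ℝ)).const_mul (d : ℝ)
  filter_upwards [hlim.eventually_lt_const hε] with k hk i hi
  have hd := h _ ⟨zero_le, gridPoint_le d (k := k) (i := i + 1) hi⟩ _
    ⟨zero_le, gridPoint_le d (k := k) (i := i) hi.le⟩ (by rwa [dist_gridPoint_succ])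
  rw [Real.dist_eq] at hd
  exact (le_abs_self _).trans hd.le

lemma ProbabilityTheory.IsBrownianReal.measure_positive_min_lt_le {X : ℝ≥0 → Ω → ℝ}
    (hX : IsBrownianReal X P) (hm : ∀ t, Measurable (X t)) (hc : ∀ ω, Continuous (X · ω))
    {a b : ℝ≥0} (hab : a ≤ b) (η : ℝ≥0) :
    P {ω | (∃ t ∈ Set.Icc a b, X t ω < η) ∧ ∀ t ∈ Set.Icc a b, 0 < X t ω} ≤
      2 * (η * min (invSqrt (b - a)) (invSqrt a)) := by
  have hP : IsProbabilityMeasure P := hX.isGaussianProcess.isProbabilityMeasure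
  rcases eq_or_ne η 0 with rfl | hη
  · have hempty : {ω | (∃ t ∈ Set.Icc a b, X t ω < (0 : ℝ≥0)) ∧
        ∀ t ∈ Set.Icc a b, 0 < X t ω} = ∅ := by
      refine Set.eq_empty_of_forall_notMem fun ω ⟨⟨t, ht, hlt⟩, hpos⟩ => ?_
      exact lt_asymm (hpos t ht) (by simpa using hlt)
    rw [hempty, measure_empty]
    exact zero_le
  have hη0 : (0 : ℝ) < η := NNReal.coe_pos.2 (pos_iff_ne_zero.2 hη)
  let d : ℝ≥0 := b - a
  have had : a + d = b := add_tsub_cancel_of_le hab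
  let Y : ℝ≥0 → Ω → ℝ := fun s ω => X (a + s) ω - X a ω
  let V : ℝ≥0 → Ω → ℝ := -Y
  have hV : IsBrownianReal V P := (hX.shift a).neg
  have hVm (s : ℝ≥0) : Measurable (V s) := ((hm _).sub (hm _)).neg
  have hVc (ω : Ω) : Continuous (V · ω) :=
    (((hc ω).comp (continuous_const.add continuous_id)).sub continuous_const).neg
  have hUV : IndepFun (X a) (fun ω s => V s ω) P := by
    have hφ : Measurable fun f : ℝ≥0 → ℝ => -f :=
      measurable_pi_lambda _ fun s => (measurable_pi_apply s).neg
    have hψ : Measurable fun f : Set.Iic a → ℝ => f ⟨a, Set.self_mem_Iic⟩ :=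
      measurable_pi_apply _
    exact ((hX.indepFun_shift a).comp hφ hψ).symm
  have hXV (s : ℝ≥0) (ω : Ω) : X (a + s) ω = X a ω - V s ω := by
    simp [V, Y]
  -- Grid points approach a time where `X < η`; the strict inequality survives by continuity, and
  -- positivity restricts to every grid.
  have hev : ∀ ω ∈ {ω | (∃ t ∈ Set.Icc a b, X t ω < η) ∧ ∀ t ∈ Set.Icc a b, 0 < X t ω},
      ∀ᶠ k in atTop,
        ω ∈ {ω | (X a ω, fun s => V s ω) ∈ gridMinSet (gridPoint d k) (k + 1) η} := by
    rintro ω ⟨⟨t, ht, hlt⟩, hpos⟩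
    have hs : t - a ≤ d := tsub_le_tsub_right ht.2 a
    obtain ⟨i, hi, hlim⟩ := exists_tendsto_gridPoint hs
    have hlim' := ((hVc ω).tendsto (t - a)).comp hlim
    have hlt' : X a ω - η < V (t - a) ω := by
      have := hXV (t - a) ω
      rw [add_tsub_cancel_of_le ht.1] at this
      linarith
    filter_upwards [hlim'.eventually_const_lt hlt'] with k hk
    refine ⟨⟨i k, hi k, hk⟩, fun j hj => ?_⟩
    have := hpos (a + gridPoint d k j)
      ⟨le_self_add, (add_le_add_right (gridPoint_le d hj) a).trans_eq had⟩
    rw [hXV] at this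
    exact sub_pos.1 this
  have hUbound : P {ω | (∃ t ∈ Set.Icc a b, X t ω < η) ∧ ∀ t ∈ Set.Icc a b, 0 < X t ω} ≤
      ENNReal.ofReal η * invSqrt a :=
    measure_le_of_eventually_mem (e := fun _ => 0) hev
      (fun k => (measure_gridMinSet_le_of_gaussian hVm (hm a) (hX.hasLaw_eval a).map_eq hUV
        _ _ _).trans (by simp)) tendsto_const_nhds
  have hVbound : P {ω | (∃ t ∈ Set.Icc a b, X t ω < η) ∧ ∀ t ∈ Set.Icc a b, 0 < X t ω} ≤
      ENNReal.ofReal (η + η) * invSqrt d := by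
    -- Overshoot tolerance `δ = η`: any fixed positive `δ` makes the error vanish, and this one
    -- costs only the factor `2`.
    refine measure_le_of_eventually_mem (B := fun k =>
        {ω | (X a ω, fun s => V s ω) ∈ gridMinSet (gridPoint d k) (k + 1) η})
      (e := fun k => 2 * P {ω | ∃ i < k + 1,
        (η : ℝ) < V (gridPoint d k (i + 1)) ω - V (gridPoint d k i) ω}) hev (fun k => ?_) ?_
    · have h := hV.measure_gridMinSet_le hVm (hm a) hUV (monotone_gridPoint d k)
        (gridPoint_zero d k) (k + 1) hη0.le hη0.le
      rwa [gridPoint_last] at h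
    · have hbad := tendsto_measure_zero_of_eventually_notMem (P := P) (B := fun k =>
          {ω | ∃ i < k + 1, (η : ℝ) < V (gridPoint d k (i + 1)) ω - V (gridPoint d k i) ω})
        (fun k => ?_) fun ω => ?_
      · simpa using ENNReal.Tendsto.const_mul hbad (.inr (ENNReal.ofNat_ne_top (n := 2)))
      · have hset : {ω | ∃ i < k + 1,
            (η : ℝ) < V (gridPoint d k (i + 1)) ω - V (gridPoint d k i) ω} =
            ⋃ i : ℕ, ⋃ _ : i < k + 1,
              {ω | (η : ℝ) < V (gridPoint d k (i + 1)) ω - V (gridPoint d k i) ω} := by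
          ext ω
          simp
        rw [hset]
        exact .iUnion fun i => .iUnion fun _ =>
          measurableSet_lt measurable_const ((hVm _).sub (hVm _))
      · filter_upwards [eventually_forall_sub_gridPoint_le (hVc ω) d hη0] with k hk
        rintro ⟨i, hi, hlt⟩
        exact (hk i hi).not_gt hlt
  rw [mul_left_comm, ← mul_assoc, mul_comm (η : ℝ≥0∞) 2]
  rcases min_choice (invSqrt (b - a)) (invSqrt a) with h | h <;> rw [h]
  · refine hVbound.trans_eq ?_
    rw [ENNReal.ofReal_add hη0.le hη0.le, ENNReal.ofReal_coe_nnreal, two_mul]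
  · refine hUbound.trans ?_
    rw [ENNReal.ofReal_coe_nnreal]
    gcongr
    exact le_mul_of_one_le_left' one_le_two

end BrownianMotion

theorem mainTheorem1 {Ω : Type*} [MeasurableSpace Ω] (P : Measure Ω)
    (W : ℝ≥0 → Ω → ℝ) (hW : IsBrownianReal W P)
    (ϑ η : ℕ → ℝ≥0)
    (hT : Tendsto (partialTime ϑ) atTop atTop)
    (hη : ∑' N : {N : ℕ // 1 ≤ N}, (η N : ℝ≥0∞) * blockWeight ϑ N < ∞) :
    ∀ᵐ ω ∂P, ∀ᶠ N : ℕ in atTop,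
      (η N : ℝ) ≤ sInf ((fun t : ℝ≥0 => |W t ω|) '' timeBlock ϑ N) ∨
        ∃ t ∈ timeBlock ϑ N, W t ω = 0 := by
  obtain ⟨X, hXm, hXc, hX, hWX⟩ := hW.exists_continuous_version
  have hmono (N : ℕ) : partialTime ϑ N ≤ partialTime ϑ (N + 1) :=
    Finset.sum_le_sum_of_subset (Finset.Icc_subset_Icc_right N.le_succ)
  let A (Z : ℝ≥0 → Ω → ℝ) (N : ℕ) : Set Ω :=
    {ω | (∃ t ∈ timeBlock ϑ N, Z t ω < η N) ∧ ∀ t ∈ timeBlock ϑ N, 0 < Z t ω}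
  have hA {Z : ℝ≥0 → Ω → ℝ} (hZ : IsBrownianReal Z P) (hZm : ∀ t, Measurable (Z t))
      (hZc : ∀ ω, Continuous (Z · ω)) : ∀ᵐ ω ∂P, ∀ᶠ N in atTop, ω ∉ A Z N := by
    -- The hypothesis does not control `N = 0`, so that event is replaced by `∅`.
    have hsum : ∑' N, P (if 1 ≤ N then A Z N else ∅) ≠ ∞ := by
      have hle (N : ℕ) : P (if 1 ≤ N then A Z N else ∅) ≤
          2 * Set.indicator {N | 1 ≤ N} (fun N => (η N : ℝ≥0∞) * blockWeight ϑ N) N := by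
        by_cases hN : 1 ≤ N
        · rw [if_pos hN, Set.indicator_of_mem (s := {N | 1 ≤ N}) hN]
          exact hZ.measure_positive_min_lt_le hZm hZc (hmono N) (η N)
        · simp [hN]
      refine ((ENNReal.tsum_le_tsum hle).trans_lt ?_).ne
      rw [ENNReal.tsum_mul_left, ← tsum_subtype {N : ℕ | 1 ≤ N}]
      exact ENNReal.mul_lt_top ENNReal.ofNat_lt_top hη
    filter_upwards [ae_eventually_notMem hsum] with ω hω
    filter_upwards [hω, eventually_ge_atTop 1] with N hN hN1
    rwa [if_pos hN1] at hN
  filter_upwards [hA hX hXm hXc, hA hX.neg (fun t => (hXm t).neg) (fun ω => (hXc ω).neg), hWX]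
    with ω hpos hneg hω
  filter_upwards [hpos, hneg] with N hposN hnegN
  simp only [hω]
  by_contra! hcon
  obtain ⟨hinf, hne⟩ := hcon
  have hnonempty : (timeBlock ϑ N).Nonempty := Set.nonempty_Icc.2 (hmono N)
  obtain ⟨_, ⟨t, ht, rfl⟩, hlt⟩ := exists_lt_of_csInf_lt (hnonempty.image _) hinf
  have hlt' := abs_lt.1 hlt
  -- Otherwise the intermediate value theorem would produce a zero in the block.
  have hsign : (∀ s ∈ timeBlock ϑ N, 0 < X s ω) ∨ ∀ s ∈ timeBlock ϑ N, X s ω < 0 := by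
    by_contra! h
    obtain ⟨⟨s, hs, hs0⟩, u, hu, hu0⟩ := h
    obtain ⟨r, hr, hr0⟩ := isPreconnected_Icc.intermediate_value hs hu
      (hXc ω).continuousOn ⟨hs0, hu0⟩
    exact hne r hr hr0
  rcases hsign with h | h
  · exact hposN ⟨⟨t, ht, hlt'.2⟩, h⟩
  · exact hnegN ⟨⟨t, ht, neg_lt.1 hlt'.1⟩, fun s hs => neg_pos.2 (h s hs)⟩
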